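/- Let $N\ge 2$ be an integer and let $f=\{f_n\}_{n=0}^N$, $q=\{q_n\}_{n=1}^N$, $w=\{w_n\}_{n=1}^N$ be real sequences with $f_n\ne 0$ for $0\le n\le N$ and $w_n>0$ for $1\le n\le N$. For $\alpha\in[0,\pi)$ and $\beta\in(0,\pi]$ consider the discrete Sturm–Liouville problem for $y=\{y_n\}_{n=0}^{N+1}$, $$-\nabla(f_n\Delta y_n)+q_ny_n=\lambda w_ny_n,\qquad 1\le n\le N,$$ where $\Delta y_n=y_{n+1}-y_n$ and $\nabla y_n=y_n-y_{n-1}$, with the separated boundary condition $\mathbf S_{\alpha,\beta}$: $$\cos\alpha\, y_0-\sin\alpha\, f_0\Delta y_0=0,\qquad \cos\beta\, y_N-\sin\beta\, f_N\Delta y_N=0.$$ A number $\lambda\in\mathbb C$ is an eigenvalue if there is a nontrivial complex solution $y$; its multiplicity is the dimension of the space of solutions. Let $\xi=\arctan(-1/f_0)+\pi$ if $f_0>0$ and $\xi=\arctan(-1/f_0)$ if $f_0<0$. All eigenvalues are real, and the number of them, counted with multiplicity, is exactly $N$ if $\alpha\ne\xi$ and $\beta\neq\pi$; exactly $N-1$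 if either $\alpha\ne\xi$ and $\beta=\pi$, or $\alpha=\xi$ and $\beta\ne\pi$; and exactly $N-2$ if $\alpha=\xi$ and $\beta=\pi$. If there are $k$ of them, write them as $\lambda_0(\alpha,\beta)\le\lambda_1(\alpha,\beta)\le\dots\le\lambda_{k-1}(\alpha,\beta)$, each repeated according to its multiplicity. Further, for any $0\le\alpha_1<\alpha_2<\xi\le\alpha_3<\alpha_4<\pi$ and $0<\beta_1<\beta_2\le\pi$: (i) For every $\beta_0\in(0,\pi)$, $$\lambda_n(\alpha_2,\beta_0)<\lambda_n(\alpha_1,\beta_0)<\lambda_n(\alpha_4,\beta_0)\quad(0\le n\le N-1),$$ $$\lambda_n(\alpha_4,\beta_0)<\lambda_n(\alpha_3,\beta_0)<\lambda_{n+1}(\alpha_2,\beta_0)\quad(0\le n\le N-2),$$ and in addition $\lambda_{N-1}(\alpha_4,\beta_0)<\lambda_{N-1}(\alpha_3,\beta_0)$ if $\alpha_3\ne\xi$. (ii) For $\beta_0=\pi$, $$\lambda_n(\alpha_2,\pi)<\lambda_n(\alpha_1,\pi)<\lambda_n(\alpha_4,\pi)\quad(0\le n\le N-2),$$ $$\lambda_n(\alpha_4,\pi)<\lambda_n(\alpha_3,\pi)<\lambda_{n+1}(\alpha_2,\pi)\quad(0\le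 n\le N-3),$$ and in addition $\lambda_{N-2}(\alpha_4,\pi)<\lambda_{N-2}(\alpha_3,\pi)$ if $\alpha_3\ne\xi$. (iii) For every $\alpha_0\in[0,\xi)\cup(\xi,\pi)$, $$\lambda_n(\alpha_0,\beta_1)<\lambda_n(\alpha_0,\beta_2)<\lambda_{n+1}(\alpha_0,\beta_1)\quad(0\le n\le N-2),$$ and in addition $\lambda_{N-1}(\alpha_0,\beta_1)<\lambda_{N-1}(\alpha_0,\beta_2)$ if $\beta_2\ne\pi$. (iv) For $\alpha_0=\xi$, $$\lambda_n(\xi,\beta_1)<\lambda_n(\xi,\beta_2)<\lambda_{n+1}(\xi,\beta_1)\quad(0\le n\le N-3),$$ and in addition $\lambda_{N-2}(\xi,\beta_1)<\lambda_{N-2}(\xi,\beta_2)$ if $\beta_2\ne\pi$. -/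

import Mathlib

/-- The coefficients `(1/f, q, w)` of a discrete Sturm-Liouville equation
`-∇(f_n Δy_n) + q_n y_n = lam w_n y_n`, `n ∈ [1, N]`. Only `f_0, …, f_N`, `q_1, …, q_N` and
`w_1, …, w_N` are ever used; the other values of the three sequences play no role. -/
structure SLEquation (N : ℕ) where
  f : ℕ → ℝ
  q : ℕ → ℝ
  w : ℕ → ℝ
  f_ne_zero : ∀ n ≤ N, f n ≠ 0
  w_pos : ∀ n, 1 ≤ n → n ≤ N → 0 < w n

/-- Coefficient matrices `(A, B)` of a boundary condition
`A (y_0, f_0 Δy_0)ᵀ + B (y_N, f_N Δy_N)ᵀ = 0`. -/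
structure BoundaryCondition where
  A : Matrix (Fin 2) (Fin 2) ℂ
  B : Matrix (Fin 2) (Fin 2) ℂ

namespace BoundaryCondition

/-- The separated self-adjoint boundary condition `S_{α,β}`:
`cos α · y_0 - sin α · f_0 Δy_0 = 0` and `cos β · y_N - sin β · f_N Δy_N = 0`. -/
noncomputable def separated (α β : ℝ) : BoundaryCondition where
  A := !![(Real.cos α : ℂ), -(Real.sin α : ℂ); 0, 0]
  B := !![0, 0; (Real.cos β : ℂ), -(Real.sin β : ℂ)]

end BoundaryCondition

namespace SLEquation

variable {N : ℕ}

/-- `f_n Δy_n = f_n (y_{n+1} - y_n)`. -/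
noncomputable def quasiDiff (ω : SLEquation N) (y : ℕ → ℂ) (n : ℕ) : ℂ :=
  (ω.f n : ℂ) * (y (n + 1) - y n)

/-- `y` solves `-∇(f_n Δy_n) + q_n y_n = z w_n y_n` for `n ∈ [1, N]`. -/
def IsSolution (ω : SLEquation N) (z : ℂ) (y : ℕ → ℂ) : Prop :=
  ∀ n, 1 ≤ n → n ≤ N →
    -(ω.quasiDiff y n - ω.quasiDiff y (n - 1)) + (ω.q n : ℂ) * y n = z * (ω.w n : ℂ) * y n

/-- `y` satisfies the boundary condition `A (y_0, f_0 Δy_0)ᵀ + B (y_N, f_N Δy_N)ᵀ = 0`. -/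
def SatisfiesBC (ω : SLEquation N) (bc : BoundaryCondition) (y : ℕ → ℂ) : Prop :=
  Matrix.mulVec bc.A ![y 0, ω.quasiDiff y 0] + Matrix.mulVec bc.B ![y N, ω.quasiDiff y N] = 0

/-- The space of solutions `y_0, …, y_{N+1}` of the boundary value problem with spectral parameter
`z`. A finite sequence `y_0, …, y_{N+1}` is stored as the sequence on `ℕ` that vanishes beyond
`N + 1`, so this is a subspace of an `(N + 2)`-dimensional space. -/
def eigenspace (ω : SLEquation N) (bc : BoundaryCondition) (z : ℂ) : Submodule ℂ (ℕ → ℂ) where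
  carrier := {y | ω.IsSolution z y ∧ ω.SatisfiesBC bc y ∧ ∀ n, N + 1 < n → y n = 0}
  zero_mem' := by
    refine ⟨fun n _ _ => by simp [quasiDiff], ?_, fun n _ => rfl⟩
    ext i
    fin_cases i <;> simp [quasiDiff]
  add_mem' := by
    rintro a b ⟨ha, ha', ha''⟩ ⟨hb, hb', hb''⟩
    refine ⟨fun n h1 h2 => ?_, ?_, fun n hn => by simp [ha'' n hn, hb'' n hn]⟩
    · have h3 := ha n h1 h2
      have h4 := hb n h1 h2
      simp only [quasiDiff, Pi.add_apply] at h3 h4 ⊢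
      linear_combination h3 + h4
    · simp only [SatisfiesBC] at ha' hb' ⊢
      ext i
      have h3 := congrFun ha' i
      have h4 := congrFun hb' i
      fin_cases i <;> simp [quasiDiff] at h3 h4 ⊢ <;> linear_combination h3 + h4
  smul_mem' := by
    rintro c a ⟨ha, ha', ha''⟩
    refine ⟨fun n h1 h2 => ?_, ?_, fun n hn => by simp [ha'' n hn]⟩
    · have h3 := ha n h1 h2
      simp only [quasiDiff, Pi.smul_apply, smul_eq_mul] at h3 ⊢
      linear_combination c * h3
    · simp only [SatisfiesBC] at ha' ⊢
      ext i
      have h3 := congrFun ha' i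
      fin_cases i <;> simp [quasiDiff] at h3 ⊢ <;> linear_combination c * h3

/-- The multiplicity of the complex number `z` as an eigenvalue of the problem: the dimension of the
space of solutions. It is positive exactly when `z` is an eigenvalue, that is, when the problem has
a nontrivial solution. -/
noncomputable def multiplicity (ω : SLEquation N) (bc : BoundaryCondition) (z : ℂ) : ℕ :=
  Module.finrank ℂ (ω.eigenspace bc z)

open Classical in
/-- `l` lists all eigenvalues of the problem in non-decreasing order, each one repeated according to
its multiplicity. Since `z` runs over `ℂ`, this includes that all eigenvalues are real. -/
def IsEigenvalueList (ω : SLEquation N) (bc : BoundaryCondition) (l : List ℝ) : Prop :=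
  l.Pairwise (· ≤ ·) ∧
    ∀ z : ℂ, ω.multiplicity bc z = (l.map (fun x : ℝ => (x : ℂ))).count z

/-- There is at most one list of eigenvalues. -/
theorem IsEigenvalueList.unique {ω : SLEquation N} {bc : BoundaryCondition} {l l' : List ℝ}
    (h : ω.IsEigenvalueList bc l) (h' : ω.IsEigenvalueList bc l') : l = l' := by
  classical
  have hp : (l.map (fun x : ℝ => (x : ℂ))).Perm (l'.map (fun x : ℝ => (x : ℂ))) := by
    rw [List.perm_iff_count]
    intro z
    have h1 := h.2 z
    have h2 := h'.2 z
    convert h1.symm.trans h2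
  have hp' : l.Perm l' := by
    have := hp.map Complex.re
    simpa [Function.comp_def] using this
  exact hp'.eq_of_pairwise (fun a b _ _ hab hba => le_antisymm hab hba) h.1 h'.1

/-- The problem has exactly `k` eigenvalues, all of them real, counted with multiplicity. -/
def HasExactlyEigenvalues (ω : SLEquation N) (bc : BoundaryCondition) (k : ℕ) : Prop :=
  ∃ l : List ℝ, ω.IsEigenvalueList bc l ∧ l.length = k

open Classical in
/-- The list `lam_0 ≤ lam_1 ≤ … ≤ lam_{k-1}` of all eigenvalues, with multiplicity (the empty list
if the eigenvalues cannot be listed like this). -/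
noncomputable def eigenvalueList (ω : SLEquation N) (bc : BoundaryCondition) : List ℝ :=
  if h : ∃ l : List ℝ, ω.IsEigenvalueList bc l then h.choose else []

/-- The `n`-th eigenvalue `lam_n`, `0 ≤ n ≤ k - 1`, of a problem with exactly `k` eigenvalues
(by convention `0` for other `n`). -/
noncomputable def nthEigenvalue (ω : SLEquation N) (bc : BoundaryCondition) (n : ℕ) : ℝ :=
  ω.eigenvalueList bc |>.getD n 0

/-- `lam_n(α, β)`, the `n`-th eigenvalue for the separated boundary condition `S_{α,β}`. -/
noncomputable def lam (ω : SLEquation N) (n : ℕ) (α β : ℝ) : ℝ :=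
  ω.nthEigenvalue (BoundaryCondition.separated α β) n

/-- The angle `ξ ∈ (0, π)`, `ξ = arctan(-1/f_0) + π` if `f_0 > 0` and `ξ = arctan(-1/f_0)` if
`f_0 < 0`. -/
noncomputable def xi (ω : SLEquation N) : ℝ :=
  if 0 < ω.f 0 then Real.arctan (-1 / ω.f 0) + Real.pi else Real.arctan (-1 / ω.f 0)

end SLEquation

/-! Let y be the solution with y_0 = sin α, f_0 Δy_0 = cos α. All its values are real polynomials in
λ, the left condition holds automatically, and the right one reads P(λ) = cos β y_N − sin β f_N Δy_N
= 0 (`sepCharPoly`). Left data fill a line, so every eigenspace has dimension at most 1 and the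
eigenvalues are the roots of P. Lagrange's identity with the conjugate solution shows that the roots
are real; with the λ-derivative, that y_N' u_N − y_N u_N' > 0, where u_N = f_N Δy_N.

This positivity gives the λ-Wronskian of two characteristic polynomials differing in one angle a
constant sign (`sepCharPoly_wronskian_left`, `sepCharPoly_wronskian_right`). Hence roots are simple
and strictly separate each other, and which polynomial owns the smallest root depends only on the
sign of the Wronskian, the parities of the degrees and the signs of the leading coefficients
(`sortedRoots_interlace`).

The leading coefficient splits into a factor in α, a factor in β and a common constant. The degree
is N, less one if α = ξ (where y_1 = 0) and less one if β = π (where P = −y_N). After multiplication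
by f_0 the α-factor is positive up to ξ and negative beyond it; this is the jump of the eigenvalue
branches at ξ. -/

section

open Polynomial

/-! ### Interlacing of real-rooted polynomials from the sign of their Wronskian -/

namespace Polynomial

/-- A polynomial that does not vanish simultaneously with its derivative has only simple roots. -/
theorem nodup_roots_of_derivative_ne_zero {P : ℝ[X]} (hP : P ≠ 0)
    (h : ∀ x, P.eval x = 0 → P.derivative.eval x ≠ 0) : P.roots.Nodup := by
  rw [Multiset.nodup_iff_count_le_one]
  intro a
  rw [count_roots]
  by_contra! hc
  obtain ⟨h1, h2⟩ := (one_lt_rootMultiplicity_iff_isRoot hP).1 hc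
  exact h a h1 h2

/-- The real roots of a polynomial in non-decreasing order. -/
noncomputable def sortedRoots (P : ℝ[X]) : List ℝ := P.roots.sort (· ≤ ·)

theorem mem_sortedRoots {P : ℝ[X]} (hP : P ≠ 0) {x : ℝ} : x ∈ P.sortedRoots ↔ P.eval x = 0 := by
  simp [sortedRoots, hP]

theorem length_sortedRoots {P : ℝ[X]} (hP : P.Splits) : P.sortedRoots.length = P.natDegree := by
  simp [sortedRoots, hP.natDegree_eq_card_roots]

/-- If the Wronskian of `P` and `Q` has no zeros, then `Q` has a root between two roots of `P`. -/
theorem exists_root_between {P Q : ℝ[X]}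
    (hW : ∀ x, (P.derivative * Q - P * Q.derivative).eval x ≠ 0) {a b : ℝ} (hab : a < b)
    (ha : P.eval a = 0) (hb : P.eval b = 0) : ∃ c, a < c ∧ c < b ∧ Q.eval c = 0 := by
  by_contra! hc
  have hQ : ∀ x ∈ Set.Icc a b, Q.eval x ≠ 0 := by
    intro x hx h0
    rcases eq_or_lt_of_le hx.1 with rfl | h1
    · exact hW a (by simp [ha, h0])
    rcases eq_or_lt_of_le hx.2 with rfl | h2
    · exact hW x (by simp [hb, h0])
    exact hc x h1 h2 h0
  -- Rolle for P/Q: the numerator of its derivative is the Wronskian.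
  obtain ⟨c, hc, h⟩ := exists_hasDerivAt_eq_zero (f := fun x => P.eval x / Q.eval x) hab
    (P.continuousOn.div Q.continuousOn hQ) (by simp [ha, hb])
    (fun x hx => (P.hasDerivAt x).fun_div (Q.hasDerivAt x) (hQ x ⟨hx.1.le, hx.2.le⟩))
  rw [div_eq_zero_iff] at h
  rcases h with h | h
  · exact hW c (by simpa using h)
  · exact hQ c ⟨hc.1.le, hc.2.le⟩ (by simpa using h)

theorem neg_one_pow_mul_prod_sub_pos (s : Multiset ℝ) (x : ℝ) (h : ∀ a ∈ s, x < a) :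
    0 < (-1) ^ s.card * (s.map (x - ·)).prod := by
  induction s using Multiset.induction_on with
  | empty => simp
  | cons a s ih =>
    have h1 := ih fun b hb => h b (Multiset.mem_cons_of_mem hb)
    have h2 := h a (Multiset.mem_cons_self a s)
    simp only [Multiset.card_cons, Multiset.map_cons, Multiset.prod_cons, pow_succ]
    nlinarith

/-- The sign of the Wronskian at the smallest root of `Q`, when all roots of `P` are larger. -/
theorem wronskian_sign_of_lt_roots {P Q : ℝ[X]} (hP0 : P ≠ 0) (hQ0 : Q ≠ 0)
    (hP : P.Splits) (hQ : Q.Splits) (hQn : Q.roots.Nodup)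
    {q : ℝ} (hq : Q.eval q = 0) (hqP : ∀ a ∈ P.roots, q < a) (hqQ : ∀ a ∈ Q.roots, q ≤ a) :
    0 < (P.derivative * Q - P * Q.derivative).eval q *
      ((-1) ^ (P.natDegree + Q.natDegree) * (P.leadingCoeff * Q.leadingCoeff)) := by
  have hmem : q ∈ Q.roots := by simpa [hQ0] using hq
  have h1 := neg_one_pow_mul_prod_sub_pos P.roots q hqP
  have h2 := neg_one_pow_mul_prod_sub_pos (Q.roots.erase q) q fun a ha =>
    lt_of_le_of_ne (hqQ a (Multiset.mem_of_mem_erase ha))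
      fun h => (h ▸ hQn.notMem_erase : a ∉ Q.roots.erase q) ha
  have hd : Q.derivative.eval q =
      Q.leadingCoeff * ((Q.roots.erase q).map (q - ·)).prod := by
    conv_lhs => rw [hQ.eq_prod_roots, ← Multiset.cons_erase hmem]
    simp [eval_multiset_prod, Multiset.map_map]
  have hc : Q.natDegree = (Q.roots.erase q).card + 1 := by
    rw [hQ.natDegree_eq_card_roots, ← Multiset.card_cons, Multiset.cons_erase hmem]
  have hPl : 0 < P.leadingCoeff ^ 2 := by have := leadingCoeff_ne_zero.2 hP0; positivity
  have hQl : 0 < Q.leadingCoeff ^ 2 := by have := leadingCoeff_ne_zero.2 hQ0; positivity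
  -- The Wronskian at q is −P(q) Q'(q). Up to leading coefficients, P(q) has sign (−1)^deg P and
  -- Q'(q) has sign (−1)^(deg Q − 1).
  rw [eval_sub, eval_mul, eval_mul, hq, hd, hP.eval_eq_prod_roots, hc, ← Nat.add_assoc, pow_succ,
    pow_add, hP.natDegree_eq_card_roots]
  have := mul_pos (mul_pos h1 h2) (mul_pos hPl hQl)
  nlinarith

/-- Strict interlacing of the roots of two real polynomials with real simple roots whose Wronskian
has a constant sign. -/
theorem sortedRoots_interlace {P Q : ℝ[X]} (hP : P.Splits) (hQ : Q.Splits)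
    (hW : ∀ x, (P.derivative * Q - P * Q.derivative).eval x *
      ((-1) ^ (P.natDegree + Q.natDegree) * (P.leadingCoeff * Q.leadingCoeff)) < 0) (n : ℕ) :
    (n < P.natDegree → n < Q.natDegree → P.sortedRoots.getD n 0 < Q.sortedRoots.getD n 0) ∧
    (n + 1 < P.natDegree → n < Q.natDegree →
      Q.sortedRoots.getD n 0 < P.sortedRoots.getD (n + 1) 0) := by
  have hP0 : P ≠ 0 := by rintro rfl; simpa using hW 0
  have hQ0 : Q ≠ 0 := by rintro rfl; simpa using hW 0
  have hW0 : ∀ x, (P.derivative * Q - P * Q.derivative).eval x ≠ 0 := fun x h => by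
    simpa [h] using hW x
  have hW0' : ∀ x, (Q.derivative * P - Q * P.derivative).eval x ≠ 0 := fun x h => by
    apply hW0 x
    simp only [eval_sub, eval_mul] at h ⊢
    linarith
  have hPn : P.roots.Nodup := nodup_roots_of_derivative_ne_zero hP0 fun x h1 h2 =>
    hW0 x (by simp [h1, h2])
  have hQn : Q.roots.Nodup := nodup_roots_of_derivative_ne_zero hQ0 fun x h1 h2 =>
    hW0 x (by simp [h1, h2])
  have key : ∀ R : ℝ[X], R ≠ 0 → R.Splits → R.roots.Nodup →
      (∀ i < R.natDegree, R.eval (R.sortedRoots.getD i 0) = 0) ∧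
      (∀ i j, i < j → j < R.natDegree → R.sortedRoots.getD i 0 < R.sortedRoots.getD j 0) ∧
      ∀ x, R.eval x = 0 → ∃ i < R.natDegree, R.sortedRoots.getD i 0 = x := by
    intro R hR0 hR hRn
    have hl := length_sortedRoots hR
    have hs : R.sortedRoots.Pairwise (· < ·) := by
      have h1 : R.sortedRoots.Pairwise (· ≤ ·) := Multiset.pairwise_sort _ _
      have h2 : R.sortedRoots.Nodup := by
        rw [← Multiset.coe_nodup, sortedRoots, Multiset.sort_eq]; exact hRn
      exact (h1.and h2).imp fun h => lt_of_le_of_ne h.1 h.2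
    refine ⟨fun i hi => ?_, fun i j hij hj => ?_, fun x hx => ?_⟩
    · rw [← mem_sortedRoots hR0, List.getD_eq_getElem _ _ (hl ▸ hi)]
      exact List.getElem_mem _
    · rw [List.getD_eq_getElem _ _ (hl ▸ hij.trans hj), List.getD_eq_getElem _ _ (hl ▸ hj)]
      exact List.pairwise_iff_getElem.1 hs i j _ _ hij
    · obtain ⟨i, hi, h⟩ := List.getElem_of_mem ((mem_sortedRoots hR0).2 hx)
      exact ⟨i, hl ▸ hi, by rw [List.getD_eq_getElem _ _ hi, h]⟩
  obtain ⟨pr, pm, ps⟩ := key P hP0 hP hPn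
  obtain ⟨qr, qm, qs⟩ := key Q hQ0 hQ hQn
  have pm' : ∀ i j, j < P.natDegree → P.sortedRoots.getD i 0 < P.sortedRoots.getD j 0 →
      i < P.natDegree → i < j := fun i j hj h hi => by
    by_contra! hji
    rcases eq_or_lt_of_le hji with rfl | hlt
    · exact lt_irrefl _ h
    · exact lt_asymm h (pm j i hlt hi)
  have qm' : ∀ i j, j < Q.natDegree → Q.sortedRoots.getD i 0 < Q.sortedRoots.getD j 0 →
      i < Q.natDegree → i < j := fun i j hj h hi => by
    by_contra! hji
    rcases eq_or_lt_of_le hji with rfl | hlt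
    · exact lt_irrefl _ h
    · exact lt_asymm h (qm j i hlt hi)
  obtain ⟨p, hp⟩ : ∃ p : ℕ → ℝ, ∀ i, P.sortedRoots.getD i 0 = p i := ⟨_, fun _ => rfl⟩
  obtain ⟨q, hq⟩ : ∃ q : ℕ → ℝ, ∀ i, Q.sortedRoots.getD i 0 = q i := ⟨_, fun _ => rfl⟩
  simp only [hp, hq] at pr pm ps pm' qr qm qs qm' ⊢
  have ne : ∀ i j, i < P.natDegree → j < Q.natDegree → p i ≠ q j := fun i j hi hj h =>
    hW0 (p i) (by rw [eval_sub, eval_mul, eval_mul, pr i hi, h, qr j hj]; ring)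
  -- The only place where the sign of the Wronskian matters: were q 0 the smallest root overall, the
  -- sign there would be the wrong one. The induction below uses only that the Wronskian has no
  -- zeros.
  have base : 0 < P.natDegree → 0 < Q.natDegree → p 0 < q 0 := by
    intro h1 h2
    by_contra! hle
    have hlt := lt_of_le_of_ne hle (ne 0 0 h1 h2).symm
    refine absurd (wronskian_sign_of_lt_roots hP0 hQ0 hP hQ hQn (qr 0 h2) ?_ ?_) (hW (q 0)).not_gt
    · intro a ha
      obtain ⟨i, hi, rfl⟩ := ps a (by simpa [hP0] using ha)
      rcases Nat.eq_zero_or_pos i with rfl | h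
      · exact hlt
      · exact hlt.trans (pm 0 i h hi)
    · intro a ha
      obtain ⟨i, hi, rfl⟩ := qs a (by simpa [hQ0] using ha)
      rcases Nat.eq_zero_or_pos i with rfl | h
      · exact le_rfl
      · exact (qm 0 i h hi).le
  induction n with
  | zero =>
    refine ⟨base, fun h1 h2 => ?_⟩
    by_contra! hle
    obtain ⟨c, hc1, hc2, hc⟩ := exists_root_between hW0 (pm 0 1 one_pos h1) (pr 0 (by omega))
      (pr 1 h1)
    obtain ⟨j, hj, rfl⟩ := qs c hc
    exact absurd (qm' j 0 h2 (hc2.trans_le hle) hj) (by omega)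
  | succ n ih =>
    have hpq : n + 1 < P.natDegree → n + 1 < Q.natDegree → p (n + 1) < q (n + 1) := by
      intro h1 h2
      by_contra! hle
      -- If q (n + 1) ≤ p (n + 1), this root of P would lie strictly between p n and p (n + 1). The
      -- second half is the same argument with the roles exchanged.
      obtain ⟨c, hc1, hc2, hc⟩ := exists_root_between hW0' (qm n (n + 1) (by omega) h2)
        (qr n (by omega)) (qr _ h2)
      obtain ⟨j, hj, rfl⟩ := ps c hc
      have hj' := pm' j (n + 1) h1 (hc2.trans_le hle) hj
      have h3 := ih.1 (by omega) (by omega)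
      exact absurd (pm' n j hj (h3.trans hc1) (by omega)) (by omega)
    refine ⟨hpq, fun h1 h2 => ?_⟩
    by_contra! hle
    obtain ⟨c, hc1, hc2, hc⟩ := exists_root_between hW0 (pm (n + 1) (n + 2) (by omega) h1)
      (pr _ (by omega)) (pr _ h1)
    obtain ⟨j, hj, rfl⟩ := qs c hc
    have hj' := qm' j (n + 1) h2 (hc2.trans_le hle) hj
    have h3 := ih.2 (by omega) (by omega)
    exact absurd (qm' n j hj (h3.trans hc1) (by omega)) (by omega)

end Polynomial

/-! ### Solutions as polynomials in λ and Lagrange identities -/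

namespace SLEquation

variable {N : ℕ}

/-- The pair `(y_n, f_n Δy_n)`, as polynomials in the spectral parameter, of the solution of the
initial value problem `y_0 = a`, `f_0 Δy_0 = b`. -/
noncomputable def solPoly (ω : SLEquation N) (a b : ℝ) : ℕ → ℝ[X] × ℝ[X]
  | 0 => (C a, C b)
  | n + 1 =>
    ((solPoly ω a b n).1 + C (ω.f n)⁻¹ * (solPoly ω a b n).2,
      (solPoly ω a b n).2 + (C (ω.q (n + 1)) - C (ω.w (n + 1)) * X) *
        ((solPoly ω a b n).1 + C (ω.f n)⁻¹ * (solPoly ω a b n).2))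

variable (ω : SLEquation N)

section

variable (a b a' b' : ℝ)

@[simp] theorem solPoly_zero_fst : (ω.solPoly a b 0).1 = C a := rfl

@[simp] theorem solPoly_zero_snd : (ω.solPoly a b 0).2 = C b := rfl

theorem solPoly_succ_fst (n : ℕ) : (ω.solPoly a b (n + 1)).1 =
    (ω.solPoly a b n).1 + C (ω.f n)⁻¹ * (ω.solPoly a b n).2 := rfl

theorem solPoly_succ_snd (n : ℕ) : (ω.solPoly a b (n + 1)).2 =
    (ω.solPoly a b n).2 + (C (ω.q (n + 1)) - C (ω.w (n + 1)) * X) *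
      (ω.solPoly a b (n + 1)).1 := rfl

theorem solPoly_linear (s t : ℝ) (n : ℕ) :
    (ω.solPoly (s * a + t * a') (s * b + t * b') n).1 =
      C s * (ω.solPoly a b n).1 + C t * (ω.solPoly a' b' n).1 ∧
    (ω.solPoly (s * a + t * a') (s * b + t * b') n).2 =
      C s * (ω.solPoly a b n).2 + C t * (ω.solPoly a' b' n).2 := by
  induction n with
  | zero => simp
  | succ n ih =>
    have h : (ω.solPoly (s * a + t * a') (s * b + t * b') (n + 1)).1 =
        C s * (ω.solPoly a b (n + 1)).1 + C t * (ω.solPoly a' b' (n + 1)).1 := by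
      simp only [solPoly_succ_fst, ih.1, ih.2]
      ring
    refine ⟨h, ?_⟩
    rw [solPoly_succ_snd, h, ih.2, solPoly_succ_snd, solPoly_succ_snd]
    ring

/-- The Casoratian of two solutions is constant. -/
theorem solPoly_casoratian (n : ℕ) :
    (ω.solPoly a b n).1 * (ω.solPoly a' b' n).2 - (ω.solPoly a b n).2 * (ω.solPoly a' b' n).1 =
      C (a * b' - b * a') := by
  induction n with
  | zero => simp
  | succ n ih =>
    rw [← ih]
    simp only [solPoly_succ_snd, solPoly_succ_fst]
    ring

/-- Lagrange identity for the derivative in the spectral parameter. -/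
theorem solPoly_derivative_identity (n : ℕ) :
    derivative (ω.solPoly a b n).1 * (ω.solPoly a b n).2 -
      (ω.solPoly a b n).1 * derivative (ω.solPoly a b n).2 =
      ∑ i ∈ Finset.range n, C (ω.w (i + 1)) * (ω.solPoly a b (i + 1)).1 ^ 2 := by
  induction n with
  | zero => simp
  | succ n ih =>
    rw [Finset.sum_range_succ, ← ih, solPoly_succ_snd, solPoly_succ_fst]
    simp only [derivative_add, derivative_mul, derivative_sub, derivative_C, derivative_X]
    ring

/-- Lagrange identity for a solution and its complex conjugate. -/
theorem solPoly_conj_identity (z : ℂ) (n : ℕ) :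
    (aeval z (ω.solPoly a b n).1).re * (aeval z (ω.solPoly a b n).2).im -
      (aeval z (ω.solPoly a b n).1).im * (aeval z (ω.solPoly a b n).2).re =
      -z.im * ∑ i ∈ Finset.range n,
        ω.w (i + 1) * Complex.normSq (aeval z (ω.solPoly a b (i + 1)).1) := by
  induction n with
  | zero => simp
  | succ n ih =>
    rw [Finset.sum_range_succ, mul_add, ← ih, solPoly_succ_snd, solPoly_succ_fst]
    simp only [map_add, map_mul, map_sub, aeval_C, aeval_X, Complex.coe_algebraMap,
      Complex.normSq_apply, Complex.add_re, Complex.add_im, Complex.mul_re, Complex.mul_im,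
      Complex.sub_re, Complex.sub_im, Complex.ofReal_re, Complex.ofReal_im]
    ring

/-- y_1 and y_2 cannot both vanish: y_1 = y_2 = 0 forces b = 0 and then a = 0. The assumption 2 ≤ N
puts both values into the sum. -/
theorem sum_normSq_pos (hN : 2 ≤ N) (hab : a ≠ 0 ∨ b ≠ 0) (z : ℂ) :
    0 < ∑ i ∈ Finset.range N,
      ω.w (i + 1) * Complex.normSq (aeval z (ω.solPoly a b (i + 1)).1) := by
  have hw : ∀ i ∈ Finset.range N, 0 < ω.w (i + 1) := fun i hi =>
    ω.w_pos _ (by omega) (by have := Finset.mem_range.1 hi; omega)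
  refine Finset.sum_pos' (fun i hi => mul_nonneg (hw i hi).le (Complex.normSq_nonneg _)) ?_
  suffices h : aeval z (ω.solPoly a b 1).1 ≠ 0 ∨ aeval z (ω.solPoly a b 2).1 ≠ 0 by
    rcases h with h | h
    · exact ⟨0, by simp; omega, mul_pos (hw 0 (by simp; omega)) (Complex.normSq_pos.2 h)⟩
    · exact ⟨1, by simp; omega, mul_pos (hw 1 (by simp; omega)) (Complex.normSq_pos.2 h)⟩
  by_contra! h
  obtain ⟨h1, h2⟩ := h
  have hf : (ω.f 1 : ℂ) ≠ 0 := by exact_mod_cast ω.f_ne_zero 1 (by omega)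
  have e : (ω.solPoly a b 2).1 = (ω.solPoly a b 1).1 + C (ω.f 1)⁻¹ *
      (C b + (C (ω.q 1) - C (ω.w 1) * X) * (ω.solPoly a b 1).1) := rfl
  rw [e, map_add, map_mul, map_add, map_mul, h1] at h2
  have hb : b = 0 := by simpa [hf] using h2
  subst hb
  have ha : a = 0 := by simpa [solPoly_succ_fst] using h1
  simp [ha] at hab

theorem eval_wronskian_pos (hN : 2 ≤ N) (hab : a ≠ 0 ∨ b ≠ 0) (x : ℝ) :
    0 < (derivative (ω.solPoly a b N).1 * (ω.solPoly a b N).2 -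
      (ω.solPoly a b N).1 * derivative (ω.solPoly a b N).2).eval x := by
  have h := ω.sum_normSq_pos a b hN hab x
  rw [solPoly_derivative_identity, eval_finsetSum]
  refine h.trans_eq (Finset.sum_congr rfl fun i _ => ?_)
  have : aeval (x : ℂ) (ω.solPoly a b (i + 1)).1 = ((ω.solPoly a b (i + 1)).1.eval x : ℝ) := by
    simpa using aeval_algebraMap_apply ℂ x (ω.solPoly a b (i + 1)).1
  rw [this, Complex.normSq_ofReal, eval_mul, eval_C, eval_pow, sq]

end

/-! ### The characteristic polynomial: real roots and Wronskian signs -/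

/-- The characteristic polynomial of the problem with boundary condition `S_{α,β}`. -/
noncomputable def sepCharPoly (α β : ℝ) : ℝ[X] :=
  C (Real.cos β) * (ω.solPoly (Real.sin α) (Real.cos α) N).1 -
    C (Real.sin β) * (ω.solPoly (Real.sin α) (Real.cos α) N).2

theorem sin_ne_zero_or_cos_ne_zero (α : ℝ) : Real.sin α ≠ 0 ∨ Real.cos α ≠ 0 := by
  by_contra! h
  simpa [h.1, h.2] using Real.sin_sq_add_cos_sq α

/-- The right condition makes (y_N, u_N) a complex multiple of the real vector (sin β, cos β), so
the imaginary part of conj(y_N) u_N is zero; Lagrange's identity equates it with −Im z times a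
positive sum. -/
theorem im_eq_zero_of_aeval_sepCharPoly (hN : 2 ≤ N) {α β : ℝ} {z : ℂ}
    (hz : aeval z (ω.sepCharPoly α β) = 0) : z.im = 0 := by
  have h1 := ω.solPoly_conj_identity (Real.sin α) (Real.cos α) z N
  have h2 := ω.sum_normSq_pos _ _ hN (sin_ne_zero_or_cos_ne_zero α) z
  simp only [sepCharPoly, map_sub, map_mul, aeval_C, Complex.coe_algebraMap] at hz
  have hre := congrArg Complex.re hz
  have him := congrArg Complex.im hz
  simp only [Complex.sub_re, Complex.sub_im, Complex.re_ofReal_mul, Complex.im_ofReal_mul,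
    Complex.zero_re, Complex.zero_im] at hre him
  have h0 : (aeval z (ω.solPoly (Real.sin α) (Real.cos α) N).1).re *
      (aeval z (ω.solPoly (Real.sin α) (Real.cos α) N).2).im -
      (aeval z (ω.solPoly (Real.sin α) (Real.cos α) N).1).im *
      (aeval z (ω.solPoly (Real.sin α) (Real.cos α) N).2).re = 0 := by
    rcases sin_ne_zero_or_cos_ne_zero β with h | h
    · apply mul_left_cancel₀ h
      linear_combination -(aeval z (ω.solPoly (Real.sin α) (Real.cos α) N).1).re * him +
        (aeval z (ω.solPoly (Real.sin α) (Real.cos α) N).1).im * hre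
    · apply mul_left_cancel₀ h
      linear_combination (aeval z (ω.solPoly (Real.sin α) (Real.cos α) N).2).im * hre -
        (aeval z (ω.solPoly (Real.sin α) (Real.cos α) N).2).re * him
  rw [h0] at h1
  simpa [h2.ne'] using h1.symm

theorem sepCharPoly_splits (hN : 2 ≤ N) (α β : ℝ) : (ω.sepCharPoly α β).Splits := by
  refine Splits.of_splits_map (algebraMap ℝ ℂ) (IsAlgClosed.splits _) fun z hz => ?_
  have h := (mem_roots'.1 hz).2
  rw [IsRoot, eval_map_algebraMap] at h
  exact ⟨z.re, Complex.ext (by simp) (by simp [ω.im_eq_zero_of_aeval_sepCharPoly hN h])⟩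

/-- By bilinearity the Wronskian is −sin(β₂ − β₁) (y_N' u_N − y_N u_N'). -/
theorem sepCharPoly_wronskian_right (hN : 2 ≤ N) (α : ℝ) {β₁ β₂ : ℝ} (h0 : 0 < β₁)
    (h : β₁ < β₂) (hπ : β₂ ≤ Real.pi) (x : ℝ) :
    (derivative (ω.sepCharPoly α β₁) * ω.sepCharPoly α β₂ -
      ω.sepCharPoly α β₁ * derivative (ω.sepCharPoly α β₂)).eval x < 0 := by
  have h1 := ω.eval_wronskian_pos _ _ hN (sin_ne_zero_or_cos_ne_zero α) x
  have h2 := Real.sin_pos_of_pos_of_lt_pi (sub_pos.2 h) (by linarith)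
  rw [Real.sin_sub] at h2
  have h3 := mul_pos h2 h1
  simp only [sepCharPoly, derivative_sub, derivative_mul, derivative_C, eval_sub, eval_mul,
    eval_add, eval_C, eval_zero] at h3 ⊢
  linarith

/-- Split the solution as sin α · p + cos α · r and let c, d be the values at x of the right
boundary form on p, r. The Wronskian is sin(α₂ − α₁)(c d' − c' d). Its second factor is the positive
quantity of `eval_wronskian_pos` for the solution with initial data (d, −c) frozen at x: by the
Casoratian that solution ends at (−sin β, −cos β). -/
theorem sepCharPoly_wronskian_left (hN : 2 ≤ N) {α₁ α₂ : ℝ} (β : ℝ) (h0 : 0 ≤ α₁)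
    (h : α₁ < α₂) (hπ : α₂ < Real.pi) (x : ℝ) :
    0 < (derivative (ω.sepCharPoly α₁ β) * ω.sepCharPoly α₂ β -
      ω.sepCharPoly α₁ β * derivative (ω.sepCharPoly α₂ β)).eval x := by
  set p := ω.solPoly 1 0 N with hp
  set r := ω.solPoly 0 1 N with hr
  have hlin : ∀ s t : ℝ, (ω.solPoly s t N).1 = C s * p.1 + C t * r.1 ∧
      (ω.solPoly s t N).2 = C s * p.2 + C t * r.2 := fun s t => by
    simpa using ω.solPoly_linear 1 0 0 1 s t N
  have hdet := congrArg (eval x) (ω.solPoly_casoratian 1 0 0 1 N)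
  rw [← hp, ← hr] at hdet
  simp only [eval_sub, eval_mul, eval_C] at hdet
  set c := Real.cos β * p.1.eval x - Real.sin β * p.2.eval x with hc
  set d := Real.cos β * r.1.eval x - Real.sin β * r.2.eval x with hd
  have e1 : d * p.1.eval x - c * r.1.eval x = -Real.sin β := by
    rw [hc, hd]; linear_combination -Real.sin β * hdet
  have e2 : d * p.2.eval x - c * r.2.eval x = -Real.cos β := by
    rw [hc, hd]; linear_combination -Real.cos β * hdet
  have hdc : d ≠ 0 ∨ -c ≠ 0 := by
    by_contra! h
    have hc0 : c = 0 := neg_eq_zero.1 h.2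
    rw [h.1, hc0] at e1 e2
    rcases sin_ne_zero_or_cos_ne_zero β with h | h <;> apply h <;> linarith
  have h1 := ω.eval_wronskian_pos d (-c) hN hdc x
  have h2 := Real.sin_pos_of_pos_of_lt_pi (sub_pos.2 h) (by linarith)
  rw [Real.sin_sub] at h2
  simp only [(hlin _ _).1, (hlin _ _).2, derivative_add, derivative_mul, derivative_C, eval_sub,
    eval_mul, eval_add, eval_C, eval_zero] at h1
  have h3 : 0 < d * (Real.sin β * p.2.derivative.eval x - Real.cos β * p.1.derivative.eval x) -
      c * (Real.sin β * r.2.derivative.eval x - Real.cos β * r.1.derivative.eval x) := by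
    refine h1.trans_eq ?_
    linear_combination (d * p.1.derivative.eval x - c * r.1.derivative.eval x) * e2 -
      (d * p.2.derivative.eval x - c * r.2.derivative.eval x) * e1
  have h4 := mul_pos h2 h3
  simp only [sepCharPoly, (hlin _ _).1, (hlin _ _).2, derivative_sub, derivative_add,
    derivative_mul, derivative_C, eval_sub, eval_mul, eval_add, eval_C, eval_zero]
  refine h4.trans_eq ?_
  rw [hc, hd]
  ring

/-! ### Eigenspaces and roots of the characteristic polynomial -/

theorem satisfiesBC_separated_iff (α β : ℝ) (y : ℕ → ℂ) :
    ω.SatisfiesBC (BoundaryCondition.separated α β) y ↔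
      (Real.cos α : ℂ) * y 0 - (Real.sin α : ℂ) * ω.quasiDiff y 0 = 0 ∧
      (Real.cos β : ℂ) * y N - (Real.sin β : ℂ) * ω.quasiDiff y N = 0 := by
  rw [SatisfiesBC, funext_iff, Fin.forall_fin_two]
  simp [BoundaryCondition.separated, sub_eq_add_neg, mul_comm]

/-- A solution with initial values proportional to `(a, b)` is the same multiple of `solPoly`. -/
theorem IsSolution.eq_solPoly {ω : SLEquation N} {z : ℂ} {y : ℕ → ℂ} (hy : ω.IsSolution z y)
    {a b : ℝ} {t : ℂ} (h0 : y 0 = t * a) (h1 : ω.quasiDiff y 0 = t * b) :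
    ∀ n ≤ N, y n = t * aeval z (ω.solPoly a b n).1 ∧
      ω.quasiDiff y n = t * aeval z (ω.solPoly a b n).2 := by
  intro n
  induction n with
  | zero => intro _; simp [h0, h1]
  | succ n ih =>
    intro hn
    obtain ⟨i1, i2⟩ := ih (by omega)
    have hf : (ω.f n : ℂ) ≠ 0 := by exact_mod_cast ω.f_ne_zero n (by omega)
    have e : y (n + 1) = t * aeval z (ω.solPoly a b (n + 1)).1 := by
      rw [solPoly_succ_fst, map_add, map_mul, mul_add, ← i1, mul_left_comm, ← i2, quasiDiff]
      simp [hf]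
    refine ⟨e, ?_⟩
    have h := hy (n + 1) (by omega) hn
    rw [Nat.add_sub_cancel, i2] at h
    rw [solPoly_succ_snd, map_add, map_mul, mul_add, mul_left_comm, ← e]
    simp only [map_sub, map_mul, aeval_C, aeval_X, Complex.coe_algebraMap]
    linear_combination -h

open Classical in
/-- The solution `solPoly` with spectral parameter `z`, cut off beyond `N + 1`. -/
noncomputable def solSeq (a b : ℝ) (z : ℂ) (n : ℕ) : ℂ :=
  if n ≤ N + 1 then aeval z (ω.solPoly a b n).1 else 0

theorem solSeq_of_le (a b : ℝ) (z : ℂ) {n : ℕ} (hn : n ≤ N + 1) :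
    ω.solSeq a b z n = aeval z (ω.solPoly a b n).1 := if_pos hn

theorem quasiDiff_solSeq (a b : ℝ) (z : ℂ) {n : ℕ} (hn : n ≤ N) :
    ω.quasiDiff (ω.solSeq a b z) n = aeval z (ω.solPoly a b n).2 := by
  have hf : (ω.f n : ℂ) ≠ 0 := by exact_mod_cast ω.f_ne_zero n hn
  rw [quasiDiff, solSeq_of_le _ _ _ _ (by omega), solSeq_of_le _ _ _ _ (by omega),
    solPoly_succ_fst]
  simp [hf]

theorem isSolution_solSeq (a b : ℝ) (z : ℂ) : ω.IsSolution z (ω.solSeq a b z) := by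
  intro n h1 h2
  obtain ⟨n, rfl⟩ := Nat.exists_eq_add_of_le' h1
  rw [Nat.add_sub_cancel, quasiDiff_solSeq _ _ _ _ h2, quasiDiff_solSeq _ _ _ _ (by omega),
    solSeq_of_le _ _ _ _ (by omega), solPoly_succ_snd]
  simp only [map_add, map_sub, map_mul, aeval_C, aeval_X, Complex.coe_algebraMap]
  ring

theorem solSeq_ne_zero {a b : ℝ} (hab : a ≠ 0 ∨ b ≠ 0) (z : ℂ) : ω.solSeq a b z ≠ 0 := by
  intro h
  have h0 := ω.solSeq_of_le a b z (n := 0) (by omega)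
  have h1 := ω.quasiDiff_solSeq a b z (n := 0) (by omega)
  rw [h] at h0 h1
  simp [quasiDiff] at h0 h1
  rcases hab with hab | hab
  · exact hab (by exact_mod_cast h0.symm)
  · exact hab (by exact_mod_cast h1.symm)

theorem aeval_sepCharPoly (α β : ℝ) (z : ℂ) : aeval z (ω.sepCharPoly α β) =
    (Real.cos β : ℂ) * aeval z (ω.solPoly (Real.sin α) (Real.cos α) N).1 -
      (Real.sin β : ℂ) * aeval z (ω.solPoly (Real.sin α) (Real.cos α) N).2 := by
  simp only [sepCharPoly, map_sub, map_mul, aeval_C, Complex.coe_algebraMap]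

/-- The left condition places (y_0, f_0 Δy_0) on the line spanned by the unit vector (sin α, cos α),
and t is its coordinate there. What remains of the right condition is t P(z) = 0. -/
theorem exists_eq_smul_solSeq {α β : ℝ} {z : ℂ} {y : ℕ → ℂ}
    (hy : y ∈ ω.eigenspace (BoundaryCondition.separated α β) z) :
    ∃ t : ℂ, y = t • ω.solSeq (Real.sin α) (Real.cos α) z ∧
      t * aeval z (ω.sepCharPoly α β) = 0 := by
  obtain ⟨hs, hbc, hv⟩ := hy
  obtain ⟨hα, hβ⟩ := (ω.satisfiesBC_separated_iff α β y).1 hbc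
  have hsc : (Real.sin α : ℂ) ^ 2 + (Real.cos α : ℂ) ^ 2 = 1 := by
    exact_mod_cast Real.sin_sq_add_cos_sq α
  have key := hs.eq_solPoly (a := Real.sin α) (b := Real.cos α)
    (t := Real.sin α * y 0 + Real.cos α * ω.quasiDiff y 0)
    (by linear_combination (Real.cos α : ℂ) * hα - y 0 * hsc)
    (by linear_combination -(Real.sin α : ℂ) * hα - ω.quasiDiff y 0 * hsc)
  generalize (Real.sin α * y 0 + Real.cos α * ω.quasiDiff y 0 : ℂ) = t at key
  refine ⟨t, ?_, ?_⟩
  · ext n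
    rw [Pi.smul_apply, smul_eq_mul]
    rcases Nat.lt_or_ge (N + 1) n with hn | hn
    · rw [hv n hn, solSeq, if_neg (by omega), mul_zero]
    rw [solSeq_of_le _ _ _ _ hn]
    rcases Nat.lt_or_ge N n with hn' | hn'
    · obtain rfl : n = N + 1 := by omega
      have hf : (ω.f N : ℂ) ≠ 0 := by exact_mod_cast ω.f_ne_zero N le_rfl
      obtain ⟨k1, k2⟩ := key N le_rfl
      rw [solPoly_succ_fst, map_add, map_mul, mul_add, ← k1, mul_left_comm, ← k2, quasiDiff]
      simp [hf]
    · exact (key n hn').1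
  · obtain ⟨k1, k2⟩ := key N le_rfl
    rw [aeval_sepCharPoly, mul_sub, mul_left_comm, ← k1, mul_left_comm, ← k2, hβ]

open Classical in
theorem multiplicity_separated (α β : ℝ) (z : ℂ) :
    ω.multiplicity (BoundaryCondition.separated α β) z =
      if aeval z (ω.sepCharPoly α β) = 0 then 1 else 0 := by
  rw [multiplicity]
  split_ifs with hz
  · have : ω.eigenspace (BoundaryCondition.separated α β) z =
        Submodule.span ℂ {ω.solSeq (Real.sin α) (Real.cos α) z} := by
      refine le_antisymm (fun y hy => ?_) ?_
      · obtain ⟨t, rfl, -⟩ := ω.exists_eq_smul_solSeq hy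
        exact Submodule.smul_mem _ _ (Submodule.mem_span_singleton_self _)
      · rw [Submodule.span_singleton_le_iff_mem]
        refine ⟨ω.isSolution_solSeq _ _ z, ?_, fun n hn => if_neg (by omega)⟩
        rw [satisfiesBC_separated_iff, quasiDiff_solSeq _ _ _ _ le_rfl,
          quasiDiff_solSeq _ _ _ _ (Nat.zero_le _), solSeq_of_le _ _ _ _ (by omega),
          solSeq_of_le _ _ _ _ (by omega), ← aeval_sepCharPoly]
        refine ⟨?_, hz⟩
        simp
        ring
    rw [this, finrank_span_singleton (ω.solSeq_ne_zero (sin_ne_zero_or_cos_ne_zero α) z)]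
  · have : ω.eigenspace (BoundaryCondition.separated α β) z = ⊥ := by
      rw [eq_bot_iff]
      intro y hy
      obtain ⟨t, rfl, ht⟩ := ω.exists_eq_smul_solSeq hy
      rcases mul_eq_zero.1 ht with rfl | h
      · simp
      · exact absurd h hz
    rw [this, finrank_bot]

/-- Eigenvalues are counted by dimension, which is at most 1, but roots algebraically; simplicity of
the roots makes the two counts agree. -/
theorem isEigenvalueList_sortedRoots {α β : ℝ} (h0 : ω.sepCharPoly α β ≠ 0)
    (hs : (ω.sepCharPoly α β).Splits) (hn : (ω.sepCharPoly α β).roots.Nodup) :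
    ω.IsEigenvalueList (BoundaryCondition.separated α β) (ω.sepCharPoly α β).sortedRoots := by
  classical
  refine ⟨Multiset.pairwise_sort _ _, fun z => ?_⟩
  have hnd : ((ω.sepCharPoly α β).sortedRoots.map (fun x : ℝ => (x : ℂ))).Nodup := by
    refine List.Nodup.map Complex.ofReal_injective ?_
    rw [← Multiset.coe_nodup, sortedRoots, Multiset.sort_eq]
    exact hn
  have hmem : z ∈ (ω.sepCharPoly α β).sortedRoots.map (fun x : ℝ => (x : ℂ)) ↔
      aeval z (ω.sepCharPoly α β) = 0 := by
    have key : ∀ x : ℝ, aeval (x : ℂ) (ω.sepCharPoly α β) = 0 ↔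
        (ω.sepCharPoly α β).eval x = 0 := fun x => by
      have : aeval (x : ℂ) (ω.sepCharPoly α β) = ((ω.sepCharPoly α β).eval x : ℝ) := by
        simpa using aeval_algebraMap_apply ℂ x (ω.sepCharPoly α β)
      rw [this, Complex.ofReal_eq_zero]
    simp only [List.mem_map, mem_sortedRoots h0]
    constructor
    · rintro ⟨x, hx, rfl⟩
      exact (key x).2 hx
    · intro hz
      obtain ⟨x, rfl⟩ := hs.mem_range_of_isRoot h0 (i := algebraMap ℝ ℂ) (x := z)
        (by rwa [IsRoot, eval_map_algebraMap])
      exact ⟨x, (key x).1 hz, rfl⟩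
  rw [multiplicity_separated]
  convert (List.Nodup.count hnd (a := z)).symm using 1
  simp only [hmem]

/-! ### Degrees and leading coefficients -/

theorem solPoly_snd_succ_degree {a b : ℝ} {n j : ℕ} (hu : (ω.solPoly a b n).2.natDegree ≤ j)
    (hy : (ω.solPoly a b (n + 1)).1.natDegree ≤ j) :
    (ω.solPoly a b (n + 1)).2.natDegree ≤ j + 1 ∧
      (ω.solPoly a b (n + 1)).2.coeff (j + 1) =
        -ω.w (n + 1) * (ω.solPoly a b (n + 1)).1.coeff j := by
  rw [solPoly_succ_snd]
  constructor
  · have h : (C (ω.q (n + 1)) - C (ω.w (n + 1)) * X).natDegree ≤ 1 := by compute_degree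
    refine natDegree_add_le_of_degree_le (by omega) ?_
    exact (natDegree_mul_le_of_le h hy).trans (Nat.add_comm 1 j).le
  · rw [coeff_add, sub_mul, coeff_sub, mul_assoc, coeff_C_mul, coeff_C_mul, coeff_X_mul,
      coeff_eq_zero_of_natDegree_lt (Nat.lt_succ_of_le hu),
      coeff_eq_zero_of_natDegree_lt (Nat.lt_succ_of_le hy)]
    ring

/-- The factor `∏ (-w_i / f_i)`, `1 ≤ i ≤ n`, of the leading coefficients of `solPoly`. -/
noncomputable def leadFactor (n : ℕ) : ℝ := ∏ i ∈ Finset.range n, -(ω.w (i + 1) / ω.f (i + 1))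

theorem leadFactor_ne_zero {n : ℕ} (hn : n ≤ N) : ω.leadFactor n ≠ 0 := by
  refine Finset.prod_ne_zero_iff.2 fun i hi => neg_ne_zero.2 (div_ne_zero ?_ ?_) <;>
    have := Finset.mem_range.1 hi
  · exact (ω.w_pos _ (by omega) (by omega)).ne'
  · exact ω.f_ne_zero _ (by omega)

/-- From the first constant y_{m+1} on, each step raises the degree by one and multiplies the
leading coefficient by −w/f. The start is m = 0 in general and m = 1 for α = ξ, where y_1 = 0;
writing the constant as σ · `leadFactor` m makes both cases end with the same product. -/
theorem solPoly_degree {a b σ : ℝ} {m : ℕ} (hu : (ω.solPoly a b m).2.natDegree ≤ 0)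
    (hy : (ω.solPoly a b (m + 1)).1 = C (σ * ω.leadFactor m)) (j : ℕ) :
    (ω.solPoly a b (m + j)).2.natDegree ≤ j ∧
      (ω.solPoly a b (m + j + 1)).1.natDegree ≤ j ∧
      (ω.solPoly a b (m + j + 1)).1.coeff j = σ * ω.leadFactor (m + j) := by
  induction j with
  | zero => exact ⟨hu, by rw [Nat.add_zero, hy, natDegree_C], by simp only [Nat.add_zero, hy, coeff_C_zero]⟩
  | succ j ih =>
    obtain ⟨i1, i2, i3⟩ := ih
    obtain ⟨h1, h2⟩ := ω.solPoly_snd_succ_degree i1 i2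
    refine ⟨h1, ?_, ?_⟩
    · rw [solPoly_succ_fst]
      exact natDegree_add_le_of_degree_le (by rw [← Nat.add_assoc]; omega)
        ((natDegree_C_mul_le _ _).trans h1)
    · rw [solPoly_succ_fst, ← Nat.add_assoc, coeff_add,
        coeff_eq_zero_of_natDegree_lt (Nat.lt_succ_of_le i2), coeff_C_mul, h2, i3, leadFactor,
        leadFactor, Finset.prod_range_succ]
      ring

/-- The equation says that the data (sin ξ, cos ξ) give y_1 = sin ξ + cos ξ / f_0 = 0. -/
theorem xi_spec : 0 < ω.xi ∧ ω.xi < Real.pi ∧ Real.cos ω.xi = -ω.f 0 * Real.sin ω.xi := by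
  have hf := ω.f_ne_zero 0 (Nat.zero_le _)
  set θ := Real.arctan (-1 / ω.f 0) with hθ
  have h1 := Real.neg_pi_div_two_lt_arctan (-1 / ω.f 0)
  have h2 := Real.arctan_lt_pi_div_two (-1 / ω.f 0)
  have hc : Real.cos θ ≠ 0 := (Real.cos_arctan_pos _).ne'
  have ht : Real.cos θ = -ω.f 0 * Real.sin θ := by
    have := Real.tan_arctan (-1 / ω.f 0)
    rw [← hθ, Real.tan_eq_sin_div_cos, div_eq_div_iff hc hf] at this
    linarith
  rw [xi]
  split_ifs with h
  · have h3 : θ < 0 := by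
      rw [hθ, Real.arctan_lt_zero]
      exact div_neg_of_neg_of_pos (by norm_num) h
    refine ⟨by linarith [Real.pi_pos], by linarith, ?_⟩
    rw [← hθ, Real.cos_add_pi, Real.sin_add_pi, ht]
    ring
  · have h3 : 0 < θ := by
      rw [hθ, Real.arctan_pos]
      exact div_pos_of_neg_of_neg (by norm_num) (lt_of_le_of_ne (not_lt.1 h) hf)
    exact ⟨h3, by linarith [Real.pi_pos], ht⟩

open Classical in
/-- The factor of the leading coefficient of `sepCharPoly` that depends on `α`. -/
noncomputable def leftFactor (α : ℝ) : ℝ :=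
  if α = ω.xi then -(Real.cos α / ω.w 1) else Real.sin α + (ω.f 0)⁻¹ * Real.cos α

open Classical in
/-- The factor of the leading coefficient of `sepCharPoly` that depends on `β`. -/
noncomputable def rightFactor (β : ℝ) : ℝ :=
  if β = Real.pi then -1 else Real.sin β * ω.w N

/-- Multiplying by f_0 removes the dependence on its sign: only the side of ξ on which α lies
matters. -/
theorem f_mul_leftFactor {α : ℝ} (hα : α ≠ ω.xi) :
    ω.f 0 * ω.leftFactor α = Real.sin (ω.xi - α) / Real.sin ω.xi := by
  obtain ⟨h1, h2, h3⟩ := ω.xi_spec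
  have hs := Real.sin_pos_of_pos_of_lt_pi h1 h2
  have hf := ω.f_ne_zero 0 (Nat.zero_le _)
  rw [leftFactor, if_neg hα, Real.sin_sub, h3]
  field_simp
  ring

/-- The angle ξ belongs to the positive side, although the degree drops there: its factor, coming
from y_2, gives f_0² sin ξ / w_1. -/
theorem f_mul_leftFactor_pos (hN : 2 ≤ N) {α : ℝ} (h0 : 0 ≤ α) (h : α ≤ ω.xi) :
    0 < ω.f 0 * ω.leftFactor α := by
  obtain ⟨h1, h2, h3⟩ := ω.xi_spec
  have hs := Real.sin_pos_of_pos_of_lt_pi h1 h2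
  rcases h.eq_or_lt with rfl | h
  · have hw := ω.w_pos 1 le_rfl (by omega)
    have hf : 0 < ω.f 0 ^ 2 := by have := ω.f_ne_zero 0 (Nat.zero_le _); positivity
    have : ω.f 0 * ω.leftFactor ω.xi = ω.f 0 ^ 2 * Real.sin ω.xi / ω.w 1 := by
      rw [leftFactor, if_pos rfl, h3]
      ring
    rw [this]
    positivity
  · rw [f_mul_leftFactor _ h.ne]
    exact div_pos (Real.sin_pos_of_pos_of_lt_pi (by linarith) (by linarith)) hs

theorem f_mul_leftFactor_neg {α : ℝ} (h : ω.xi < α) (hπ : α < Real.pi) :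
    ω.f 0 * ω.leftFactor α < 0 := by
  obtain ⟨h1, h2, h3⟩ := ω.xi_spec
  have hs := Real.sin_pos_of_pos_of_lt_pi h1 h2
  rw [f_mul_leftFactor _ h.ne']
  exact div_neg_of_neg_of_pos (Real.sin_neg_of_neg_of_neg_pi_lt (by linarith) (by linarith)) hs

theorem leftFactor_ne_zero (hN : 2 ≤ N) {α : ℝ} (hα : α ∈ Set.Ico 0 Real.pi) :
    ω.leftFactor α ≠ 0 := by
  intro h
  rcases le_or_gt α ω.xi with h' | h'
  · simpa [h] using ω.f_mul_leftFactor_pos hN hα.1 h'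
  · simpa [h] using ω.f_mul_leftFactor_neg h' hα.2

theorem rightFactor_pos (hN : 2 ≤ N) {β : ℝ} (h0 : 0 < β) (h : β < Real.pi) :
    0 < ω.rightFactor β := by
  rw [rightFactor, if_neg h.ne]
  exact mul_pos (Real.sin_pos_of_pos_of_lt_pi h0 h) (ω.w_pos N (by omega) le_rfl)

theorem rightFactor_pi : ω.rightFactor Real.pi = -1 := if_pos rfl

theorem rightFactor_ne_zero (hN : 2 ≤ N) {β : ℝ} (hβ : β ∈ Set.Ioc 0 Real.pi) :
    ω.rightFactor β ≠ 0 := by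
  rcases hβ.2.eq_or_lt with rfl | h
  · simp [rightFactor_pi]
  · exact (ω.rightFactor_pos hN hβ.1 h).ne'

open Classical in
/-- The number of eigenvalues for the boundary condition `S_{α,β}`. -/
noncomputable def numEigenvalues (α β : ℝ) : ℕ :=
  N - (if α = ω.xi then 1 else 0) - (if β = Real.pi then 1 else 0)

theorem solPoly_sin_cos_degree (hN : 2 ≤ N) (α : ℝ) : ∃ j,
    j + 1 = N - (open Classical in if α = ω.xi then 1 else 0) ∧
    (ω.solPoly (Real.sin α) (Real.cos α) N).1.natDegree ≤ j ∧
    (ω.solPoly (Real.sin α) (Real.cos α) N).1.coeff j =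
      ω.leftFactor α * ω.leadFactor (N - 1) ∧
    (ω.solPoly (Real.sin α) (Real.cos α) N).2.natDegree ≤ j + 1 ∧
    (ω.solPoly (Real.sin α) (Real.cos α) N).2.coeff (j + 1) =
      -ω.w N * (ω.leftFactor α * ω.leadFactor (N - 1)) := by
  have base : ∃ m, m = (open Classical in if α = ω.xi then 1 else 0) ∧
      (ω.solPoly (Real.sin α) (Real.cos α) m).2.natDegree ≤ 0 ∧
      (ω.solPoly (Real.sin α) (Real.cos α) (m + 1)).1 =
        C (ω.leftFactor α * ω.leadFactor m) := by
    by_cases h : α = ω.xi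
    · refine ⟨1, by simp [h], ?_⟩
      have hf := ω.f_ne_zero 0 (Nat.zero_le _)
      have hw := (ω.w_pos 1 le_rfl (by omega)).ne'
      have hf1 := ω.f_ne_zero 1 (by omega)
      have hs : Real.sin α = -((ω.f 0)⁻¹ * Real.cos α) := by
        rw [h, ω.xi_spec.2.2]
        field_simp
      have h1 : (ω.solPoly (Real.sin α) (Real.cos α) 1).1 = 0 := by
        rw [solPoly_succ_fst, solPoly_zero_fst, solPoly_zero_snd, ← C_mul, ← C_add, hs]
        simp
      have h2 : (ω.solPoly (Real.sin α) (Real.cos α) 1).2 = C (Real.cos α) := by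
        rw [solPoly_succ_snd, h1, solPoly_zero_snd]
        simp
      refine ⟨by simp [h2], ?_⟩
      -- Here y_2 = cos ξ / f_1; the −1/w_1 in `leftFactor` cancels the surplus −w_1 of `leadFactor`
      -- 1.
      rw [solPoly_succ_fst, h1, h2, zero_add, ← C_mul, leftFactor, if_pos h, leadFactor,
        Finset.prod_range_one]
      congr 1
      field_simp
    · refine ⟨0, by simp [h], by simp, ?_⟩
      rw [solPoly_succ_fst, solPoly_zero_fst, solPoly_zero_snd, leftFactor, if_neg h, leadFactor]
      simp
  obtain ⟨m, hm, hu, hy⟩ := base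
  have hm1 : m ≤ 1 := by rw [hm]; split_ifs <;> simp
  obtain ⟨j, hj⟩ : ∃ j, N = m + j + 1 := ⟨N - m - 1, by omega⟩
  obtain ⟨h1, h2, h3⟩ := ω.solPoly_degree hu hy j
  obtain ⟨h4, h5⟩ := ω.solPoly_snd_succ_degree h1 h2
  rw [← hm]
  refine ⟨j, by omega, ?_⟩
  rw [show N - 1 = m + j by omega]
  rw [← hj] at h2 h3 h4 h5
  exact ⟨h2, h3, h4, by rw [h5, h3]⟩

theorem sepCharPoly_natDegree_leadingCoeff (hN : 2 ≤ N) {α β : ℝ} (hα : α ∈ Set.Ico 0 Real.pi)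
    (hβ : β ∈ Set.Ioc 0 Real.pi) :
    (ω.sepCharPoly α β).natDegree = ω.numEigenvalues α β ∧
    (ω.sepCharPoly α β).leadingCoeff =
      ω.rightFactor β * ω.leftFactor α * ω.leadFactor (N - 1) := by
  have hne : ω.rightFactor β * ω.leftFactor α * ω.leadFactor (N - 1) ≠ 0 :=
    mul_ne_zero (mul_ne_zero (ω.rightFactor_ne_zero hN hβ) (ω.leftFactor_ne_zero hN hα))
      (ω.leadFactor_ne_zero (by omega))
  suffices h : (ω.sepCharPoly α β).natDegree ≤ ω.numEigenvalues α β ∧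
      (ω.sepCharPoly α β).coeff (ω.numEigenvalues α β) =
        ω.rightFactor β * ω.leftFactor α * ω.leadFactor (N - 1) by
    have hd := natDegree_eq_of_le_of_coeff_ne_zero h.1 (h.2 ▸ hne)
    exact ⟨hd, by rw [leadingCoeff, hd, h.2]⟩
  obtain ⟨j, hj, h1, h2, h3, h4⟩ := ω.solPoly_sin_cos_degree hN α
  rw [numEigenvalues, ← hj]
  by_cases h : β = Real.pi
  · have : ω.sepCharPoly α β = -(ω.solPoly (Real.sin α) (Real.cos α) N).1 := by
      simp [sepCharPoly, h]
    rw [if_pos h, this, Nat.add_sub_cancel, natDegree_neg, coeff_neg, h2, rightFactor, if_pos h]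
    exact ⟨h1, by ring⟩
  · rw [if_neg h, Nat.sub_zero, sepCharPoly, rightFactor, if_neg h, coeff_sub, coeff_C_mul,
      coeff_C_mul, h4, coeff_eq_zero_of_natDegree_lt (Nat.lt_succ_of_le h1)]
    exact ⟨(natDegree_sub_le _ _).trans (max_le ((natDegree_C_mul_le _ _).trans (by omega))
      ((natDegree_C_mul_le _ _).trans h3)), by ring⟩

/-! ### The eigenvalue list and its length -/

theorem sepCharPoly_ne_zero (hN : 2 ≤ N) {α β : ℝ} (hα : α ∈ Set.Ico 0 Real.pi) :
    ω.sepCharPoly α β ≠ 0 := by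
  intro h
  -- Any second angle in (α, π) will do: a zero polynomial would make this positive Wronskian
  -- vanish. A double root is excluded below in the same way.
  have := ω.sepCharPoly_wronskian_left hN β hα.1 (show α < (α + Real.pi) / 2 by linarith [hα.2])
    (by linarith [hα.2]) 0
  simp [h] at this

theorem isEigenvalueList_separated (hN : 2 ≤ N) {α β : ℝ} (hα : α ∈ Set.Ico 0 Real.pi) :
    ω.IsEigenvalueList (BoundaryCondition.separated α β) (ω.sepCharPoly α β).sortedRoots := by
  refine ω.isEigenvalueList_sortedRoots (ω.sepCharPoly_ne_zero hN hα)
    (ω.sepCharPoly_splits hN α β)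
    (nodup_roots_of_derivative_ne_zero (ω.sepCharPoly_ne_zero hN hα) fun x h1 h2 => ?_)
  have := ω.sepCharPoly_wronskian_left hN β hα.1 (show α < (α + Real.pi) / 2 by linarith [hα.2])
    (by linarith [hα.2]) x
  simp [h1, h2] at this

theorem hasExactlyEigenvalues_separated (hN : 2 ≤ N) {α β : ℝ} (hα : α ∈ Set.Ico 0 Real.pi)
    (hβ : β ∈ Set.Ioc 0 Real.pi) : ω.HasExactlyEigenvalues (BoundaryCondition.separated α β)
      (ω.numEigenvalues α β) :=
  ⟨_, ω.isEigenvalueList_separated hN hα, by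
    rw [length_sortedRoots (ω.sepCharPoly_splits hN α β),
      (ω.sepCharPoly_natDegree_leadingCoeff hN hα hβ).1]⟩

theorem lam_eq (hN : 2 ≤ N) {α β : ℝ} (hα : α ∈ Set.Ico 0 Real.pi) (n : ℕ) :
    ω.lam n α β = (ω.sepCharPoly α β).sortedRoots.getD n 0 := by
  have h : ∃ l, ω.IsEigenvalueList (BoundaryCondition.separated α β) l :=
    ⟨_, ω.isEigenvalueList_separated hN hα⟩
  rw [lam, nthEigenvalue, eigenvalueList, dif_pos h,
    h.choose_spec.unique (ω.isEigenvalueList_separated hN hα)]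

/-! ### Interlacing of the eigenvalues in each angle -/

/-- Strict interlacing of the eigenvalues for `S_{α,β}` and `S_{α',β'}`, starting with those for
`S_{α,β}`. -/
def Interlace (α β α' β' : ℝ) : Prop := ∀ n,
  (n < ω.numEigenvalues α β → n < ω.numEigenvalues α' β' → ω.lam n α β < ω.lam n α' β') ∧
  (n + 1 < ω.numEigenvalues α β → n < ω.numEigenvalues α' β' →
    ω.lam n α' β' < ω.lam (n + 1) α β)

/-- The square of `leadFactor` in the product of leading coefficients is positive and drops out; the
square of f_0 is inserted so that the sign lemmas for f_0 · `leftFactor` apply. -/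
theorem interlace_of_wronskian (hN : 2 ≤ N) {α β α' β' : ℝ} (hα : α ∈ Set.Ico 0 Real.pi)
    (hβ : β ∈ Set.Ioc 0 Real.pi) (hα' : α' ∈ Set.Ico 0 Real.pi) (hβ' : β' ∈ Set.Ioc 0 Real.pi)
    (h : ∀ x, (derivative (ω.sepCharPoly α β) * ω.sepCharPoly α' β' -
      ω.sepCharPoly α β * derivative (ω.sepCharPoly α' β')).eval x *
      ((-1) ^ (ω.numEigenvalues α β + ω.numEigenvalues α' β') *
        (ω.rightFactor β * ω.rightFactor β' *
          ((ω.f 0 * ω.leftFactor α) * (ω.f 0 * ω.leftFactor α')))) < 0) :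
    ω.Interlace α β α' β' := by
  intro n
  obtain ⟨d1, l1⟩ := ω.sepCharPoly_natDegree_leadingCoeff hN hα hβ
  obtain ⟨d2, l2⟩ := ω.sepCharPoly_natDegree_leadingCoeff hN hα' hβ'
  rw [ω.lam_eq hN hα, ω.lam_eq hN hα', ω.lam_eq hN hα, ← d1, ← d2]
  refine sortedRoots_interlace (ω.sepCharPoly_splits hN α β) (ω.sepCharPoly_splits hN α' β')
    (fun x => ?_) n
  rw [d1, d2, l1, l2]
  have hf : 0 < ω.f 0 ^ 2 := by have := ω.f_ne_zero 0 (Nat.zero_le _); positivity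
  have hK : 0 < ω.leadFactor (N - 1) ^ 2 := by
    have := ω.leadFactor_ne_zero (n := N - 1) (by omega); positivity
  by_contra! hc
  have h1 := mul_nonneg hc hf.le
  have h2 := mul_neg_of_neg_of_pos (h x) hK
  exact absurd (lt_of_eq_of_lt (by ring) h2) h1.not_gt

theorem wronskian_swap_neg {P Q : ℝ[X]} {x : ℝ}
    (h : 0 < (derivative P * Q - P * derivative Q).eval x) :
    (derivative Q * P - Q * derivative P).eval x < 0 := by
  simp only [eval_sub, eval_mul] at h ⊢
  linarith

theorem rightFactor_mul_self_pos (hN : 2 ≤ N) {β : ℝ} (hβ : β ∈ Set.Ioc 0 Real.pi) :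
    0 < ω.rightFactor β * ω.rightFactor β :=
  mul_self_pos.2 (ω.rightFactor_ne_zero hN hβ)

theorem interlace_left_of_lt_xi (hN : 2 ≤ N) {α₁ α₂ β : ℝ} (h0 : 0 ≤ α₁) (h : α₁ < α₂)
    (hξ : α₂ < ω.xi) (hβ : β ∈ Set.Ioc 0 Real.pi) : ω.Interlace α₂ β α₁ β := by
  have hπ := ω.xi_spec.2.1
  refine ω.interlace_of_wronskian hN ⟨by linarith, by linarith⟩ hβ ⟨h0, by linarith⟩ hβ
    fun x => mul_neg_of_neg_of_pos
      (wronskian_swap_neg (ω.sepCharPoly_wronskian_left hN β h0 h (by linarith) x)) ?_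
  rw [Even.neg_one_pow ⟨N - (if β = Real.pi then 1 else 0), by
    simp [numEigenvalues, hξ.ne, (h.trans hξ).ne]⟩, one_mul]
  exact mul_pos (ω.rightFactor_mul_self_pos hN hβ)
    (mul_pos (ω.f_mul_leftFactor_pos hN (by linarith) hξ.le)
      (ω.f_mul_leftFactor_pos hN h0 (by linarith)))

/-- The Wronskian is positive, so exactly one sign change is needed. For α₂ > ξ it comes from the
leading coefficients, for α₂ = ξ from the odd sum of the degrees. -/
theorem interlace_left_across_xi (hN : 2 ≤ N) {α₁ α₂ β : ℝ} (h0 : 0 ≤ α₁) (h1 : α₁ < ω.xi)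
    (h2 : ω.xi ≤ α₂) (hπ : α₂ < Real.pi) (hβ : β ∈ Set.Ioc 0 Real.pi) :
    ω.Interlace α₁ β α₂ β := by
  refine ω.interlace_of_wronskian hN ⟨h0, by linarith⟩ hβ ⟨by linarith, hπ⟩ hβ
    fun x => mul_neg_of_pos_of_neg
      (ω.sepCharPoly_wronskian_left hN β h0 (by linarith) hπ x) ?_
  have p1 := ω.f_mul_leftFactor_pos hN h0 h1.le
  have pβ := ω.rightFactor_mul_self_pos hN hβ
  rcases h2.eq_or_lt with rfl | h2
  · rw [Odd.neg_one_pow ⟨N - 1 - (if β = Real.pi then 1 else 0), by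
      simp only [numEigenvalues, h1.ne, if_true, if_false]; split_ifs <;> omega⟩, neg_one_mul]
    exact neg_neg_of_pos (mul_pos pβ (mul_pos p1
      (ω.f_mul_leftFactor_pos hN (by linarith) le_rfl)))
  · rw [Even.neg_one_pow ⟨N - (if β = Real.pi then 1 else 0), by
      simp [numEigenvalues, h1.ne, h2.ne']⟩, one_mul]
    exact mul_neg_of_pos_of_neg pβ (mul_neg_of_pos_of_neg p1 (ω.f_mul_leftFactor_neg h2 hπ))

/-- At α₁ = ξ the leading coefficients differ in sign and the degree sum is odd; the two changes
cancel. -/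
theorem interlace_left_of_xi_le (hN : 2 ≤ N) {α₁ α₂ β : ℝ} (hξ : ω.xi ≤ α₁) (h : α₁ < α₂)
    (hπ : α₂ < Real.pi) (hβ : β ∈ Set.Ioc 0 Real.pi) : ω.Interlace α₂ β α₁ β := by
  have h0 : 0 ≤ α₁ := ω.xi_spec.1.le.trans hξ
  refine ω.interlace_of_wronskian hN ⟨by linarith, by linarith⟩ hβ ⟨h0, by linarith⟩ hβ
    fun x => mul_neg_of_neg_of_pos
      (wronskian_swap_neg (ω.sepCharPoly_wronskian_left hN β h0 h hπ x)) ?_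
  have n2 := ω.f_mul_leftFactor_neg (hξ.trans_lt h) hπ
  have pβ := ω.rightFactor_mul_self_pos hN hβ
  rcases hξ.eq_or_lt with rfl | hξ
  · rw [Odd.neg_one_pow ⟨N - 1 - (if β = Real.pi then 1 else 0), by
      simp only [numEigenvalues, h.ne', if_true, if_false]; split_ifs <;> omega⟩, neg_one_mul]
    exact neg_pos_of_neg (mul_neg_of_pos_of_neg pβ (mul_neg_of_neg_of_pos n2
      (ω.f_mul_leftFactor_pos hN h0 le_rfl)))
  · rw [Even.neg_one_pow ⟨N - (if β = Real.pi then 1 else 0), by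
      simp [numEigenvalues, hξ.ne', (hξ.trans h).ne']⟩, one_mul]
    exact mul_pos pβ (mul_pos_of_neg_of_neg n2 (ω.f_mul_leftFactor_neg hξ (by linarith)))

/-- At β₂ = π the odd degree sum is offset by the factor −1 of `rightFactor`. -/
theorem interlace_right (hN : 2 ≤ N) {α β₁ β₂ : ℝ} (hα : α ∈ Set.Ico 0 Real.pi) (h0 : 0 < β₁)
    (h : β₁ < β₂) (hπ : β₂ ≤ Real.pi) : ω.Interlace α β₁ α β₂ := by
  refine ω.interlace_of_wronskian hN hα ⟨h0, by linarith⟩ hα ⟨by linarith, hπ⟩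
    fun x => mul_neg_of_neg_of_pos (ω.sepCharPoly_wronskian_right hN α h0 h hπ x) ?_
  have p1 := ω.rightFactor_pos hN h0 (h.trans_le hπ)
  have pα : 0 < (ω.f 0 * ω.leftFactor α) * (ω.f 0 * ω.leftFactor α) :=
    mul_self_pos.2 (mul_ne_zero (ω.f_ne_zero 0 (Nat.zero_le _)) (ω.leftFactor_ne_zero hN hα))
  rcases hπ.eq_or_lt with rfl | hπ
  · rw [Odd.neg_one_pow ⟨N - 1 - (if α = ω.xi then 1 else 0), by
      simp only [numEigenvalues, h.ne, if_true, if_false]; split_ifs <;> omega⟩, neg_one_mul,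
      rightFactor_pi]
    exact neg_pos_of_neg (mul_neg_of_neg_of_pos (by linarith) pα)
  · rw [Even.neg_one_pow ⟨N - (if α = ω.xi then 1 else 0), by
      simp [numEigenvalues, (h.trans hπ).ne, hπ.ne]⟩, one_mul]
    exact mul_pos (mul_pos p1 (ω.rightFactor_pos hN (h0.trans h) hπ)) pα

/-! ### Eigenvalue counts and the chains of inequalities -/

theorem numEigenvalues_of_ne_ne {α β : ℝ} (hα : α ≠ ω.xi) (hβ : β ≠ Real.pi) :
    ω.numEigenvalues α β = N := by
  simp [numEigenvalues, hα, hβ]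

theorem numEigenvalues_of_ne_pi {α : ℝ} (hα : α ≠ ω.xi) :
    ω.numEigenvalues α Real.pi = N - 1 := by
  simp [numEigenvalues, hα]

theorem numEigenvalues_xi_of_ne {β : ℝ} (hβ : β ≠ Real.pi) :
    ω.numEigenvalues ω.xi β = N - 1 := by
  simp [numEigenvalues, hβ]

theorem numEigenvalues_xi_pi : ω.numEigenvalues ω.xi Real.pi = N - 2 := by
  simp [numEigenvalues, Nat.sub_sub]


/-- The inequalities between the eigenvalues for fixed `β` as `α` varies; `k` is the number of
eigenvalues for `α ≠ ξ`. -/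
theorem lam_left_inequalities (hN : 2 ≤ N) {α₁ α₂ α₃ α₄ β : ℝ} (h0 : 0 ≤ α₁) (h12 : α₁ < α₂)
    (h2 : α₂ < ω.xi) (h3 : ω.xi ≤ α₃) (h34 : α₃ < α₄) (h4 : α₄ < Real.pi)
    (hβ : β ∈ Set.Ioc 0 Real.pi) {k : ℕ} (hk : 1 ≤ k)
    (hne : ∀ α, α ≠ ω.xi → ω.numEigenvalues α β = k) (hxi : ω.numEigenvalues ω.xi β = k - 1) :
    (∀ n ≤ k - 1, ω.lam n α₂ β < ω.lam n α₁ β ∧ ω.lam n α₁ β < ω.lam n α₄ β) ∧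
    (∀ n, n + 1 ≤ k - 1 → ω.lam n α₄ β < ω.lam n α₃ β ∧ ω.lam n α₃ β < ω.lam (n + 1) α₂ β) ∧
    (α₃ ≠ ω.xi → ω.lam (k - 1) α₄ β < ω.lam (k - 1) α₃ β) := by
  have d1 := hne α₁ (h12.trans h2).ne
  have d2 := hne α₂ h2.ne
  have d4 := hne α₄ (h3.trans_lt h34).ne'
  -- α₃ = ξ is allowed and has one eigenvalue fewer, so only indices below k − 1 are safe for α₃.
  have d3 : k - 1 ≤ ω.numEigenvalues α₃ β := by
    by_cases h : α₃ = ω.xi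
    · rw [h, hxi]
    · rw [hne _ h]; omega
  have i21 := ω.interlace_left_of_lt_xi hN h0 h12 h2 hβ
  have i14 := ω.interlace_left_across_xi hN h0 (h12.trans h2) (h3.trans h34.le) h4 hβ
  have i43 := ω.interlace_left_of_xi_le hN h3 h34 h4 hβ
  -- Used only for the inequality with shifted index, which links one chain to the next.
  have i23 := ω.interlace_left_across_xi hN (h0.trans h12.le) h2 h3 (h34.trans h4) hβ
  refine ⟨fun n hn => ⟨(i21 n).1 (by omega) (by omega), (i14 n).1 (by omega) (by omega)⟩,
    fun n hn => ⟨(i43 n).1 (by omega) (by omega), (i23 n).2 (by omega) (by omega)⟩, fun h => ?_⟩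
  have d3' := hne α₃ h
  exact (i43 (k - 1)).1 (by omega) (by omega)

/-- The inequalities between the eigenvalues for fixed `α` as `β` varies; `k` is the number of
eigenvalues for `β ≠ π`. -/
theorem lam_right_inequalities (hN : 2 ≤ N) {α β₁ β₂ : ℝ} (hα : α ∈ Set.Ico 0 Real.pi)
    (h0 : 0 < β₁) (h12 : β₁ < β₂) (hπ : β₂ ≤ Real.pi) {k : ℕ} (hk : 1 ≤ k)
    (hne : ∀ β, β ≠ Real.pi → ω.numEigenvalues α β = k)
    (hpi : ω.numEigenvalues α Real.pi = k - 1) :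
    (∀ n, n + 1 ≤ k - 1 → ω.lam n α β₁ < ω.lam n α β₂ ∧ ω.lam n α β₂ < ω.lam (n + 1) α β₁) ∧
    (β₂ ≠ Real.pi → ω.lam (k - 1) α β₁ < ω.lam (k - 1) α β₂) := by
  have d1 := hne β₁ (h12.trans_le hπ).ne
  have d2 : k - 1 ≤ ω.numEigenvalues α β₂ := by
    by_cases h : β₂ = Real.pi
    · rw [h, hpi]
    · rw [hne _ h]; omega
  have i := ω.interlace_right hN hα h0 h12 hπ
  refine ⟨fun n hn => ⟨(i n).1 (by omega) (by omega), (i n).2 (by omega) (by omega)⟩, fun h => ?_⟩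
  have d2' := hne β₂ h
  exact (i (k - 1)).1 (by omega) (by omega)

end SLEquation

end

theorem theorem3p1 (N : ℕ) (hN : 2 ≤ N) (ω : SLEquation N) :
    -- the number of eigenvalues
    (∀ α ∈ Set.Ico 0 Real.pi, ∀ β ∈ Set.Ioc 0 Real.pi,
      ((α ≠ ω.xi ∧ β ≠ Real.pi) →
        ω.HasExactlyEigenvalues (BoundaryCondition.separated α β) N) ∧
      ((α ≠ ω.xi ∧ β = Real.pi) ∨ (α = ω.xi ∧ β ≠ Real.pi) →
        ω.HasExactlyEigenvalues (BoundaryCondition.separated α β) (N - 1)) ∧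
      ((α = ω.xi ∧ β = Real.pi) →
        ω.HasExactlyEigenvalues (BoundaryCondition.separated α β) (N - 2))) ∧
    ∀ α₁ α₂ α₃ α₄ : ℝ, 0 ≤ α₁ → α₁ < α₂ → α₂ < ω.xi → ω.xi ≤ α₃ → α₃ < α₄ → α₄ < Real.pi →
    ∀ β₁ β₂ : ℝ, 0 < β₁ → β₁ < β₂ → β₂ ≤ Real.pi →
      -- (i)
      (∀ β₀ ∈ Set.Ioo 0 Real.pi,
        (∀ n ≤ N - 1, ω.lam n α₂ β₀ < ω.lam n α₁ β₀ ∧ ω.lam n α₁ β₀ < ω.lam n α₄ β₀) ∧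
        (∀ n, n + 1 ≤ N - 1 →
          ω.lam n α₄ β₀ < ω.lam n α₃ β₀ ∧ ω.lam n α₃ β₀ < ω.lam (n + 1) α₂ β₀) ∧
        (α₃ ≠ ω.xi → ω.lam (N - 1) α₄ β₀ < ω.lam (N - 1) α₃ β₀)) ∧
      -- (ii)
      ((∀ n ≤ N - 2, ω.lam n α₂ Real.pi < ω.lam n α₁ Real.pi ∧
          ω.lam n α₁ Real.pi < ω.lam n α₄ Real.pi) ∧
        (∀ n, n + 1 ≤ N - 2 → ω.lam n α₄ Real.pi < ω.lam n α₃ Real.pi ∧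
          ω.lam n α₃ Real.pi < ω.lam (n + 1) α₂ Real.pi) ∧
        (α₃ ≠ ω.xi → ω.lam (N - 2) α₄ Real.pi < ω.lam (N - 2) α₃ Real.pi)) ∧
      -- (iii)
      (∀ α₀ ∈ Set.Ico 0 ω.xi ∪ Set.Ioo ω.xi Real.pi,
        (∀ n, n + 1 ≤ N - 1 →
          ω.lam n α₀ β₁ < ω.lam n α₀ β₂ ∧ ω.lam n α₀ β₂ < ω.lam (n + 1) α₀ β₁) ∧
        (β₂ ≠ Real.pi → ω.lam (N - 1) α₀ β₁ < ω.lam (N - 1) α₀ β₂)) ∧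
      -- (iv)
      ((∀ n, n + 1 ≤ N - 2 → ω.lam n ω.xi β₁ < ω.lam n ω.xi β₂ ∧
          ω.lam n ω.xi β₂ < ω.lam (n + 1) ω.xi β₁) ∧
        (β₂ ≠ Real.pi → ω.lam (N - 2) ω.xi β₁ < ω.lam (N - 2) ω.xi β₂)) := by
  obtain ⟨hξ0, hξπ, -⟩ := ω.xi_spec
  refine ⟨fun α hα β hβ => ?_, ?_⟩
  · have h := ω.hasExactlyEigenvalues_separated hN hα hβ
    refine ⟨?_, ?_, ?_⟩
    · rintro ⟨h1, h2⟩
      rwa [ω.numEigenvalues_of_ne_ne h1 h2] at h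
    · rintro (⟨h1, rfl⟩ | ⟨rfl, h2⟩)
      · rwa [ω.numEigenvalues_of_ne_pi h1] at h
      · rwa [ω.numEigenvalues_xi_of_ne h2] at h
    · rintro ⟨rfl, rfl⟩
      rwa [ω.numEigenvalues_xi_pi] at h
  intro α₁ α₂ α₃ α₄ h0 h12 h2 h3 h34 h4 β₁ β₂ hβ0 hβ hβπ
  refine ⟨fun β₀ hβ₀ => ?_, ?_, fun α₀ hα₀ => ?_, ?_⟩
  · exact ω.lam_left_inequalities hN h0 h12 h2 h3 h34 h4 ⟨hβ₀.1, hβ₀.2.le⟩ (by omega)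
      (fun α hα => ω.numEigenvalues_of_ne_ne hα hβ₀.2.ne) (ω.numEigenvalues_xi_of_ne hβ₀.2.ne)
  · exact ω.lam_left_inequalities hN h0 h12 h2 h3 h34 h4 ⟨Real.pi_pos, le_rfl⟩ (k := N - 1)
      (by omega) (fun α hα => ω.numEigenvalues_of_ne_pi hα) ω.numEigenvalues_xi_pi
  · have hne : α₀ ≠ ω.xi := by rcases hα₀ with h | h; exacts [h.2.ne, h.1.ne']
    have hmem : α₀ ∈ Set.Ico 0 Real.pi := by
      rcases hα₀ with h | h
      exacts [⟨h.1, h.2.trans hξπ⟩, ⟨(hξ0.trans h.1).le, h.2⟩]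
    exact ω.lam_right_inequalities hN hmem hβ0 hβ hβπ (by omega)
      (fun β hβ => ω.numEigenvalues_of_ne_ne hne hβ) (ω.numEigenvalues_of_ne_pi hne)
  · exact ω.lam_right_inequalities hN ⟨hξ0.le, hξπ⟩ hβ0 hβ hβπ (k := N - 1) (by omega)
      (fun β hβ => ω.numEigenvalues_xi_of_ne hβ) ω.numEigenvalues_xi_pi
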